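/- Let $G$ be a group. For $b,g\in G$ write $b^g=g^{-1}bg$. A subset $X\subseteq G$ is a *strong sandwich set* if 1. $\langle a,b^{g}\rangle$ is nilpotent of class at most $2$ for all $a,b\in X$ and all $g\in\langle X\rangle$; and 2. $\langle a,b^{f},c^{g}\rangle$ is nilpotent of class at most $3$ for all $a,b,c\in X$ and all $f,g\in\langle X\rangle$. The group $G$ is a *strong sandwich group* if it is generated by some strong sandwich set. **Theorem.** Every finitely generated strong sandwich group is nilpotent. -/

import Mathlib

/-- The subgroup `H` is nilpotent, of nilpotency class at most `n`. -/
def IsNilpotentOfClassLE {G : Type*} [Group G] (H : Subgroup G) (n : ℕ) : Prop :=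
  Group.IsNilpotent H ∧ Group.nilpotencyClass H ≤ n

/-- A strong sandwich set `X` in a group `G`. The conjugate `b ^ g` is `g⁻¹ * b * g`. -/
structure IsStrongSandwichSet {G : Type*} [Group G] (X : Set G) : Prop where
  class_two : ∀ a ∈ X, ∀ b ∈ X, ∀ g ∈ Subgroup.closure X,
    IsNilpotentOfClassLE (Subgroup.closure {a, g⁻¹ * b * g}) 2
  class_three : ∀ a ∈ X, ∀ b ∈ X, ∀ c ∈ X,
    ∀ f ∈ Subgroup.closure X, ∀ g ∈ Subgroup.closure X,
      IsNilpotentOfClassLE (Subgroup.closure {a, f⁻¹ * b * f, g⁻¹ * c * g}) 3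

/-- A strong sandwich group: a group generated by some strong sandwich set. -/
def IsStrongSandwichGroup (G : Type*) [Group G] : Prop :=
  ∃ X : Set G, IsStrongSandwichSet X ∧ Subgroup.closure X = ⊤

/-! The class conditions make the set `S` of all conjugates of elements of `X` and of their
inverses, with the identity, a sandwich set: for `a ∈ S` the conjugates of `a` under `S` commute
pairwise. Adjoining all commutators preserves this (`IsSandwich.union_commutators`), so `S` lies in
a commutator-closed sandwich set `T`. In `T` both `[[g,c],c]` and `[[[g,c],e],c]` are trivial.

Order finitely many elements of `T`. Starting from `g ∈ T`, repeatedly take the commutator with the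
largest of them that does not commute with the current element. If this never stops, the words read
off have every length. On such greedy words the bracketing of a Lyndon word acts like the word read
letter by letter (`IsLyndon.exists_bracket`). Every factor-closed language with words of all lengths
over a finite alphabet contains `uu` or `uvu` with `u`, `v` Lyndon (`exists_isLyndon_repetition`),
and the two identities kill both patterns.

Hence `T` is trivial as soon as only its identity commutes with all the chosen elements. This holds
modulo the union `Z` of the upper central series of `G`, the chosen elements being the images of
finitely many generators. So these generators lie in `Z`, and hence in a single term of the series.
-/

/-! ### Infinite words and bracketed words -/

section Words

variable {α : Type*}

/-- The factor of length `n` starting at position `i` of the infinite word `M`. -/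
def seg (M : ℕ → α) (i n : ℕ) : List α := (List.range n).map fun k => M (i + k)

theorem seg_length (M : ℕ → α) (i n : ℕ) : (seg M i n).length = n := by simp [seg]

theorem seg_add (M : ℕ → α) (i m n : ℕ) : seg M i (m + n) = seg M i m ++ seg M (i + m) n := by
  simp [seg, List.range_add, Function.comp_def, add_assoc]

theorem seg_one (M : ℕ → α) (i : ℕ) : seg M i 1 = [M i] := by simp [seg]

theorem seg_succ (M : ℕ → α) (i n : ℕ) : seg M i (n + 1) = seg M i n ++ [M (i + n)] := by
  rw [seg_add, seg_one]

theorem seg_congr {M : ℕ → α} {i j n : ℕ} (h : ∀ k < n, M (i + k) = M (j + k)) :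
    seg M i n = seg M j n := by
  simpa [seg] using h

theorem seg_inj {M : ℕ → α} {i j n : ℕ} (h : seg M i n = seg M j n) :
    ∀ k < n, M (i + k) = M (j + k) := by
  simpa [seg] using h

/-- A set of words closed under passing to factors. -/
def FactorClosed (F : Set (List α)) : Prop := ∀ u v w, u ++ v ++ w ∈ F → v ∈ F

/-- A set of words containing words of every length. -/
def HasAllLengths (F : Set (List α)) : Prop := ∀ n, ∃ w ∈ F, w.length = n

theorem FactorClosed.left {F : Set (List α)} (hF : FactorClosed F) {u v : List α}
    (h : u ++ v ∈ F) : u ∈ F := hF [] u v (by simpa using h)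

theorem FactorClosed.right {F : Set (List α)} (hF : FactorClosed F) {u v : List α}
    (h : u ++ v ∈ F) : v ∈ F := hF u v [] (by simpa using h)

/-- Zorn's lemma, downwards. Only finitely many words have length `n`, so in a chain a member with
the fewest of them has all its words of length `n` in every other member. -/
theorem exists_minimal_language [Finite α] (L : Set (List α)) (hL : FactorClosed L)
    (hL' : HasAllLengths L) :
    ∃ F ⊆ L, FactorClosed F ∧ HasAllLengths F ∧
      ∀ F' ⊆ F, FactorClosed F' → HasAllLengths F' → F' = F := by
  obtain ⟨F, hFL, hF⟩ := zorn_superset_nonempty {F | FactorClosed F ∧ HasAllLengths F} (by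
    intro c hc hchain hne
    refine ⟨⋂₀ c, ⟨?_, ?_⟩, fun s hs => Set.sInter_subset_of_mem hs⟩
    · intro u v w h s hs
      exact (hc hs).1 u v w (h s hs)
    · intro n
      have hfin : {w : List α | w.length = n}.Finite := List.finite_length_eq α n
      let f : Set (List α) → ℕ := fun s => (s ∩ {w | w.length = n}).ncard
      obtain ⟨s, hs, hmin⟩ := exists_minimalFor_of_wellFoundedLT (· ∈ c) f hne
      obtain ⟨w, hw, hwn⟩ := (hc hs).2 n
      refine ⟨w, fun t ht => ?_, hwn⟩
      rcases hchain.total hs ht with hst | hts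
      · exact hst hw
      · have hsub : t ∩ {w | w.length = n} ⊆ s ∩ {w | w.length = n} :=
          Set.inter_subset_inter_left _ hts
        have hle : f s ≤ f t := hmin ht (Set.ncard_le_ncard hsub (hfin.subset Set.inter_subset_right))
        have := Set.eq_of_subset_of_ncard_le hsub hle (hfin.subset Set.inter_subset_right)
        have hw' : w ∈ s ∩ {w | w.length = n} := ⟨hw, hwn⟩
        rw [← this] at hw'
        exact hw'.1) L ⟨hL, hL'⟩
  exact ⟨F, hFL, hF.prop.1, hF.prop.2, fun F' h h1 h2 => h.antisymm (hF.2 ⟨h1, h2⟩ h)⟩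

/-- If words of every length in a minimal language avoided `w`, those avoiding `w` would form a
smaller language of the same kind. -/
theorem exists_uniformly_recurrent_language [Finite α] (L : Set (List α)) (hL : FactorClosed L)
    (hL' : HasAllLengths L) :
    ∃ F ⊆ L, FactorClosed F ∧ HasAllLengths F ∧
      ∀ w ∈ F, ∃ N, ∀ v ∈ F, v.length = N → w <:+: v := by
  obtain ⟨F, hFL, hF, hF', hmin⟩ := exists_minimal_language L hL hL'
  refine ⟨F, hFL, hF, hF', fun w hw => ?_⟩
  by_contra! hcon
  have := hmin {v ∈ F | ¬ w <:+: v} (fun v hv => hv.1) (fun u v t h => ⟨hF u v t h.1, fun hv =>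
    h.2 (hv.trans ⟨u, t, rfl⟩)⟩) (fun n => by
      obtain ⟨v, h1, h2, h3⟩ := hcon n
      exact ⟨v, ⟨h1, h3⟩, h2⟩)
  rw [← this] at hw
  exact hw.2 (List.infix_refl w)

variable [LinearOrder α]

/-- At the first position where `w` and `u` differ, `w` has the smaller letter. -/
def LexBelow (w u : List α) : Prop :=
  ∃ r a b w' u', w = r ++ a :: w' ∧ u = r ++ b :: u' ∧ a < b

/-- Lyndon words, built up by their bracketings. -/
inductive IsLyndon : List α → Prop
  | letter (a : α) : IsLyndon [a]
  | append {p q : List α} : IsLyndon p → IsLyndon q → LexBelow (p ++ q) q → IsLyndon (p ++ q)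

theorem LexBelow.append_singleton {w u : List α} {a b : α} (hl : w.length = u.length)
    (h : LexBelow (w ++ [a]) (u ++ [b])) : LexBelow w u ∨ (w = u ∧ a < b) := by
  obtain ⟨r, c, d, w', u', h1, h2, hcd⟩ := h
  rcases List.eq_nil_or_concat w' with rfl | ⟨w'', e, rfl⟩
  · have hu : u' = [] := by
      have := congrArg List.length h1
      have := congrArg List.length h2
      simp at *
      exact List.length_eq_zero_iff.1 (by omega)
    subst hu
    obtain ⟨rfl, h1⟩ := List.append_inj' h1 rfl
    obtain ⟨rfl, h2⟩ := List.append_inj' h2 rfl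
    simp at h1 h2
    subst h1 h2
    exact Or.inr ⟨rfl, hcd⟩
  · rcases List.eq_nil_or_concat u' with rfl | ⟨u'', f, rfl⟩
    · have := congrArg List.length h1
      have := congrArg List.length h2
      simp at *
      omega
    · left
      have e1 : w ++ [a] = (r ++ c :: w'') ++ [e] := by simpa using h1
      have e2 : u ++ [b] = (r ++ d :: u'') ++ [f] := by simpa using h2
      exact ⟨r, c, d, w'', u'', (List.append_inj' e1 rfl).1, (List.append_inj' e2 rfl).1, hcd⟩

/-- A uniformly recurrent language contains an infinite word that is recurrent and lexicographically
minimal among its tails. -/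
theorem exists_minimal_word [Finite α] (F : Set (List α)) (hF : FactorClosed F)
    (hF' : HasAllLengths F) (hrec : ∀ w ∈ F, ∃ N, ∀ v ∈ F, v.length = N → w <:+: v) :
    ∃ M : ℕ → α, (∀ i n, seg M i n ∈ F) ∧
      (∀ i d, (∀ k < d, M (i + k) = M k) → M d ≤ M (i + d)) ∧
      ∀ l, ∃ s, 0 < s ∧ ∀ k < l, M (s + k) = M k := by
  -- A word of length `N + 1` still contains `w` after its last letter is dropped, so some letter
  -- follows `w`.
  have hext : ∀ w ∈ F, ∃ a, w ++ [a] ∈ F := by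
    intro w hw
    obtain ⟨N, hN⟩ := hrec w hw
    obtain ⟨v, hv, hvN⟩ := hF' (N + 1)
    rcases List.eq_nil_or_concat v with rfl | ⟨v', a, rfl⟩
    · simp at hvN
    · rw [List.concat_eq_append] at hv hvN
      obtain ⟨s, t, rfl⟩ := hN v' (hF.left hv) (by simpa using hvN)
      rcases t with _ | ⟨b, t⟩
      · exact ⟨a, hF s _ [] (by simpa using hv)⟩
      · exact ⟨b, hF s _ (t ++ [a]) (by simpa using hv)⟩
  have hmin : ∀ w : F, ∃ a, w.1 ++ [a] ∈ F ∧ ∀ b, w.1 ++ [b] ∈ F → a ≤ b := by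
    intro w
    obtain ⟨a, ha⟩ := hext w.1 w.2
    obtain ⟨b, hb, hb'⟩ := Set.exists_min_image {a | w.1 ++ [a] ∈ F} id (Set.toFinite _) ⟨a, ha⟩
    exact ⟨b, hb, hb'⟩
  choose next hnext hnext' using hmin
  have hnil : ([] : List α) ∈ F := by
    obtain ⟨w, hw, h0⟩ := hF' 0
    rwa [List.length_eq_zero_iff.1 h0] at hw
  let P : ℕ → F := fun n => Nat.rec ⟨[], hnil⟩ (fun _ w => ⟨w.1 ++ [next w], hnext w⟩) n
  let M : ℕ → α := fun n => next (P n)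
  have hP : ∀ n, (P n).1 = seg M 0 n := by
    intro n
    induction n with
    | zero => rfl
    | succ n ih =>
      rw [seg_succ, ← ih, zero_add]
  have hseg : ∀ i n, seg M i n ∈ F := by
    intro i n
    have h := (P (i + n)).2
    rw [hP, seg_add, zero_add] at h
    exact hF.right h
  have hlex : ∀ n, ∀ w ∈ F, w.length = n → ¬ LexBelow w (seg M 0 n) := by
    intro n
    induction n with
    | zero =>
      rintro w - - ⟨r, a, b, w', u', -, h, -⟩
      simp [seg] at h
    | succ n ih =>
      intro w hw hwn hlt
      rcases List.eq_nil_or_concat w with rfl | ⟨v, a, rfl⟩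
      · simp at hwn
      · rw [List.concat_eq_append] at *
        have hvn : v.length = n := by simpa using hwn
        rw [seg_succ] at hlt
        rcases LexBelow.append_singleton (by rw [seg_length, hvn]) hlt with h | ⟨h, hab⟩
        · exact ih v (hF.left hw) hvn h
        · rw [h, ← hP] at hw
          have := hnext' (P n) a hw
          rw [zero_add] at hab
          exact absurd hab (not_lt.2 this)
  refine ⟨M, hseg, fun i d h => ?_, fun l => ?_⟩
  · by_contra! hlt
    refine hlex (d + 1) _ (hseg i (d + 1)) (seg_length _ _ _) ?_
    refine ⟨seg M 0 d, M (i + d), M d, [], [], ?_, ?_, hlt⟩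
    · rw [seg_succ, seg_congr (i := i) (j := 0)]
      simpa using h
    · rw [seg_succ, zero_add]
  -- Searching for the prefix from position 1 onwards forces `s` to be positive.
  · obtain ⟨N, hN⟩ := hrec _ (hseg 0 l)
    obtain ⟨s, t, hst⟩ := hN _ (hseg 1 N) (seg_length _ _ _)
    refine ⟨1 + s.length, by omega, ?_⟩
    have hlen : N = s.length + (l + t.length) := by
      have := congrArg List.length hst
      simp only [List.length_append, seg_length] at this
      omega
    rw [hlen, seg_add, seg_add, List.append_assoc] at hst
    have h1 := (List.append_inj hst (by rw [seg_length])).2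
    have h2 := (List.append_inj h1 (by rw [seg_length, seg_length])).1
    intro k hk
    simpa using (seg_inj h2 k hk).symm

end Words

/-! ### Lyndon repetitions in infinite words -/

section Overlap

variable {α : Type*}

theorem StrictMono.exists_between {ℓ : ℕ → ℕ} (hℓ : StrictMono ℓ) {d : ℕ} (h : ℓ 0 ≤ d) :
    ∃ t, ℓ t ≤ d ∧ d < ℓ (t + 1) := by
  have hex : ∃ t, d < ℓ (t + 1) := ⟨d, lt_of_lt_of_le (Nat.lt_succ_self d) (hℓ.id_le _)⟩
  classical
  refine ⟨Nat.find hex, ?_, Nat.find_spec hex⟩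
  rcases h0 : Nat.find hex with _ | t
  · exact h
  · have := Nat.find_min hex (m := t) (by omega)
    omega

/-- The lengths `ℓ j` and overlaps `d j` of a greedy factorization of prefixes of `M`. -/
structure OverlapSequence (M : ℕ → α) (ℓ d : ℕ → ℕ) : Prop where
  zero : ℓ 0 = 1
  succ : ∀ j, ℓ (j + 1) = ℓ j + d j + 1
  agree : ∀ j, ∀ k < d j, M (ℓ j + k) = M k

namespace OverlapSequence

variable {M : ℕ → α} {ℓ d : ℕ → ℕ}

theorem strictMono (h : OverlapSequence M ℓ d) : StrictMono ℓ :=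
  strictMono_nat_of_lt_succ fun j => by rw [h.succ]; omega

theorem exists_le_lt (h : OverlapSequence M ℓ d) {n : ℕ} (hn : 0 < n) :
    ∃ t e, n = ℓ t + e ∧ e ≤ d t := by
  obtain ⟨t, h1, h2⟩ := h.strictMono.exists_between (d := n) (by rw [h.zero]; omega)
  rw [h.succ] at h2
  exact ⟨t, n - ℓ t, by omega, by omega⟩

theorem pos (h : OverlapSequence M ℓ d) (j : ℕ) : 0 < ℓ j := by
  have := h.strictMono.monotone (Nat.zero_le j)
  rw [h.zero] at this
  omega

/-- Writing `n = ℓ t + e` with `e ≤ d t`, the last `e` letters again form a prefix of `M`; descend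
from `n` to `e` until `e = 0`. -/
theorem exists_suffix (h : OverlapSequence M ℓ d) (n : ℕ) (hn : 0 < n) :
    ∃ t, ℓ t ≤ n ∧ ∀ i < ℓ t, M (n - ℓ t + i) = M i := by
  induction n using Nat.strong_induction_on with
  | _ n ih =>
    obtain ⟨t, e, rfl, he⟩ := h.exists_le_lt hn
    have := h.pos t
    rcases Nat.eq_zero_or_pos e with rfl | he0
    · exact ⟨t, by omega, fun i _ => by simp⟩
    · obtain ⟨t', h1, h2⟩ := ih e (by omega) he0
      refine ⟨t', by omega, fun i hi => ?_⟩
      rw [← h2 i hi, ← h.agree t (e - ℓ t' + i) (by omega)]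
      congr 1
      omega

variable [LinearOrder α]

/-- With `n = ℓ t + e`, the word splits into the Lyndon prefix of length `ℓ t` and the prefix of
length `e` followed by `x`. The latter is Lyndon by induction, because minimality gives `M e ≤ M n <
x`; the same inequality makes the whole word fall below it at position `e`. -/
theorem isLyndon_append (h : OverlapSequence M ℓ d)
    (hmin : ∀ i d, (∀ k < d, M (i + k) = M k) → M d ≤ M (i + d)) (j : ℕ)
    (hj : ∀ t ≤ j, IsLyndon (seg M 0 (ℓ t))) (n : ℕ) (hn : n < ℓ (j + 1)) (x : α)
    (hx : M n < x) : IsLyndon (seg M 0 n ++ [x]) := by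
  induction n using Nat.strong_induction_on with
  | _ n ih =>
    rcases Nat.eq_zero_or_pos n with rfl | hn0
    · exact IsLyndon.letter x
    · obtain ⟨t, e, rfl, he⟩ := h.exists_le_lt hn0
      have htj : t ≤ j := Nat.lt_succ_iff.1 (h.strictMono.lt_iff_lt.1 (by omega : ℓ t < ℓ (j + 1)))
      have ht := h.pos t
      have hle : M e ≤ M (ℓ t + e) := hmin _ _ fun k hk => h.agree t k (by omega)
      have heq : seg M (ℓ t) e = seg M 0 e :=
        seg_congr fun k hk => by rw [zero_add]; exact h.agree t k (by omega)
      have hex : M e < x := hle.trans_lt hx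
      rw [seg_add, zero_add, heq, List.append_assoc]
      refine (hj t htj).append (ih e (by omega) (by omega) hex) ?_
      obtain ⟨c, hc⟩ : ∃ c, ℓ t = c + 1 := ⟨ℓ t - 1, by omega⟩
      refine ⟨seg M 0 e, M e, x, seg M (e + 1) c ++ [x], [], ?_, rfl, hex⟩
      have : seg M 0 (ℓ t) ++ seg M 0 e = seg M 0 (e + 1 + c) := by
        rw [← heq, show e + 1 + c = ℓ t + e by omega, seg_add, zero_add]
      rw [← List.append_assoc, this, seg_add, seg_succ]
      simp

theorem isLyndon_succ (h : OverlapSequence M ℓ d)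
    (hmin : ∀ i d, (∀ k < d, M (i + k) = M k) → M d ≤ M (i + d)) (j : ℕ)
    (hj : ∀ t ≤ j, IsLyndon (seg M 0 (ℓ t))) (hne : M (ℓ j + d j) ≠ M (d j)) :
    IsLyndon (seg M 0 (ℓ (j + 1))) := by
  have hlt : M (d j) < M (ℓ j + d j) := lt_of_le_of_ne (hmin _ _ (h.agree j)) hne.symm
  have heq : seg M (ℓ j) (d j) = seg M 0 (d j) :=
    seg_congr fun k hk => by rw [zero_add]; exact h.agree j k hk
  have ht := h.pos j
  obtain ⟨c, hc⟩ : ∃ c, ℓ j = c + 1 := ⟨ℓ j - 1, by omega⟩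
  rw [h.succ, seg_succ, seg_add, zero_add, heq, zero_add, List.append_assoc]
  refine (hj j le_rfl).append (h.isLyndon_append hmin j hj (d j) (by rw [h.succ]; omega) _ hlt) ?_
  refine ⟨seg M 0 (d j), M (d j), _, seg M (d j + 1) c ++ [M (ℓ j + d j)], [], ?_, rfl, hlt⟩
  have : seg M 0 (ℓ j) ++ seg M 0 (d j) = seg M 0 (d j + 1 + c) := by
    rw [← heq, show d j + 1 + c = ℓ j + d j by omega, seg_add, zero_add]
  rw [← List.append_assoc, this, seg_add, seg_succ]
  simp

end OverlapSequence

theorem exists_overlapSequence (M : ℕ → α) :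
    ∃ ℓ d, OverlapSequence M ℓ d ∧
      ∀ j, (∃ k, M (ℓ j + k) ≠ M k) → M (ℓ j + d j) ≠ M (d j) := by
  -- If there is no mismatch, the infimum is 0 and the agreement condition is empty; the second
  -- claim assumes a mismatch.
  let D : ℕ → ℕ := fun l => sInf {k | M (l + k) ≠ M k}
  let ℓ : ℕ → ℕ := fun j => Nat.rec 1 (fun _ l => l + D l + 1) j
  refine ⟨ℓ, fun j => D (ℓ j), ⟨rfl, fun j => rfl, fun j k hk => ?_⟩, fun j hj => ?_⟩
  · have := Nat.notMem_of_lt_sInf hk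
    simpa using this
  · exact Nat.sInf_mem (s := {k | M (ℓ j + k) ≠ M k}) hj

/-- A language over a finite alphabet with words of every length contains a square of a Lyndon word,
or two occurrences of a Lyndon word separated by a Lyndon word. -/
theorem exists_isLyndon_repetition [Finite α] [LinearOrder α] (L : Set (List α))
    (hL : FactorClosed L) (hL' : HasAllLengths L) :
    ∃ u, IsLyndon u ∧ (u ++ u ∈ L ∨ ∃ v, IsLyndon v ∧ u ++ v ++ u ∈ L) := by
  by_contra! hcon
  obtain ⟨F, hFL, hF, hF', hrec⟩ := exists_uniformly_recurrent_language L hL hL'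
  obtain ⟨M, hMF, hmin, hocc⟩ := exists_minimal_word F hF hF' hrec
  have hsq : ∀ u, IsLyndon u → u ++ u ∉ F := fun u hu h => (hcon u hu).1 (hFL h)
  have hsep : ∀ u v, IsLyndon u → IsLyndon v → u ++ v ++ u ∉ F :=
    fun u v hu hv h => (hcon u hu).2 v hv (hFL h)
  obtain ⟨ℓ, d, h, hne'⟩ := exists_overlapSequence M
  have hne : ∀ j, IsLyndon (seg M 0 (ℓ j)) → M (ℓ j + d j) ≠ M (d j) := by
    intro j hj
    apply hne'
    -- Without a mismatch, `M` would begin with the square of its prefix of length `ℓ j`.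
    by_contra! hk
    refine hsq _ hj ?_
    have : seg M 0 (ℓ j + ℓ j) = seg M 0 (ℓ j) ++ seg M 0 (ℓ j) := by
      rw [seg_add, zero_add]
      congr 1
      exact seg_congr fun k _ => by rw [hk, zero_add]
    rw [← this]
    exact hMF _ _
  have hq : ∀ j, IsLyndon (seg M 0 (ℓ j)) := by
    intro j
    induction j using Nat.strong_induction_on with
    | _ j ih =>
      rcases j with _ | j
      · rw [h.zero, seg_one]
        exact IsLyndon.letter _
      · exact h.isLyndon_succ hmin j (fun t ht => ih t (by omega)) (hne j (ih j (by omega)))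
  have hgt : ∀ j, M (d j) < M (ℓ j + d j) := fun j =>
    lt_of_le_of_ne (hmin _ _ (h.agree j)) (hne j (hq j)).symm
  have hseg : ∀ {p l : ℕ}, (∀ k < l, M (p + k) = M k) → seg M p l = seg M 0 l := fun hp =>
    seg_congr fun k hk => by rw [zero_add]; exact hp k hk
  -- The first return `s > 0` of the prefix of length `ℓ j` is shown to be `ℓ m + 1` with `d m = 0`.
  have key : ∀ j, ∃ m, d m = 0 ∧ ∀ k < ℓ j, M (ℓ m + 1 + k) = M k := by
    intro j
    classical
    have hex := hocc (ℓ j)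
    obtain ⟨hs0, hs⟩ := Nat.find_spec hex
    have hsmin : ∀ p, p < Nat.find hex → 0 < p → ¬ ∀ k < ℓ j, M (p + k) = M k :=
      fun p hp hp0 hk => Nat.find_min hex hp ⟨hp0, hk⟩
    generalize Nat.find hex = s at *
    obtain ⟨n, e, rfl, he⟩ := h.exists_le_lt hs0
    have hn := h.pos n
    have he0 : e = 0 := by
      by_contra he0
      -- A return inside the overlap would copy to the earlier position `e`. One that covers the
      -- mismatch at `ℓ n + d n` would put there the letter `M (d n - e) ≤ M (d n)`, which is too
      -- small.
      by_cases hej : e + ℓ j ≤ d n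
      · refine hsmin e (by omega) (by omega) fun k hk => ?_
        rw [← hs k hk, ← h.agree n (e + k) (by omega), add_assoc]
      · have h1 : M (d n - e) ≤ M (e + (d n - e)) := hmin e _ fun k hk => by
          rw [← hs k (by omega), ← h.agree n (e + k) (by omega), add_assoc]
        have h2 := hs (d n - e) (by omega)
        have h3 := hgt n
        rw [show ℓ n + e + (d n - e) = ℓ n + d n by omega] at h2
        rw [show e + (d n - e) = d n by omega, ← h2] at h1
        exact absurd h3 (not_lt.2 h1)
    subst he0
    rw [add_zero] at hs hsmin
    rcases n with _ | m
    · exfalso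
      have h1 := hs 0 (h.pos j)
      rw [h.zero] at h1
      refine hsq [M 0] (IsLyndon.letter _) ?_
      have := hMF 0 2
      rwa [seg_succ, seg_one, zero_add, show M 1 = M 0 from h1] at this
    · have hm := h.succ m
      have hmpos := h.pos m
      have hd0 : d m = 0 := by
        by_contra hd0
        -- A prefix of length `ℓ t` ends just before the letter preceding the return. If it is at
        -- least as long as the returning prefix, that prefix returns earlier; otherwise two copies
        -- of it are separated by a single letter.
        obtain ⟨t, ht1, ht2⟩ := h.exists_suffix (d m) (by omega)
        have hpt : ∀ i < ℓ t, M (ℓ m + d m - ℓ t + i) = M i := by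
          intro i hi
          rw [← ht2 i hi, ← h.agree m (d m - ℓ t + i) (by omega)]
          congr 1
          omega
        rcases le_total (ℓ j) (ℓ t) with hjt | htj
        · exact hsmin (ℓ m + d m - ℓ t) (by omega) (by omega) fun k hk => hpt k (by omega)
        · refine hsep (seg M 0 (ℓ t)) [M (ℓ m + d m)] (hq t) (IsLyndon.letter _) ?_
          have h1 := hMF (ℓ m + d m - ℓ t) (ℓ t + 1 + ℓ t)
          have e1 : ℓ m + d m - ℓ t + (ℓ t + 1) = ℓ (m + 1) := by omega
          have e2 : ℓ m + d m - ℓ t + ℓ t = ℓ m + d m := by omega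
          rwa [seg_add, seg_succ, e1, e2, hseg hpt, hseg fun k hk => hs k (by omega)] at h1
      refine ⟨m, hd0, fun k hk => ?_⟩
      rw [← hs k hk, hm, hd0, add_zero]
  choose m hm0 hm using key
  -- By pigeonhole one letter `c` precedes infinitely many of these returns. A return long enough to
  -- contain position `ℓ (m j)` of the prefix then yields `c`, a Lyndon prefix, and `c` again.
  obtain ⟨c, hc⟩ := Finite.exists_infinite_fiber fun j => M (ℓ (m j))
  have hinf : ((fun j => M (ℓ (m j))) ⁻¹' {c}).Infinite := Set.infinite_coe_iff.1 hc
  obtain ⟨j, hj⟩ := hinf.nonempty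
  obtain ⟨j', hj', hlt⟩ := hinf.exists_gt (m j)
  simp only [Set.mem_preimage, Set.mem_singleton_iff] at hj hj'
  have hlen : ℓ (m j) + 1 ≤ ℓ j' := h.strictMono hlt
  have h1 := hMF (ℓ (m j')) (1 + ℓ (m j) + 1)
  have hprefix : ∀ k < ℓ (m j), M (ℓ (m j') + 1 + k) = M k := fun k hk => hm j' k (by omega)
  have hlast := hm j' (ℓ (m j)) (by omega)
  rw [seg_add, seg_add, seg_one, seg_one, hseg hprefix, hj', ← add_assoc, hlast, hj] at h1
  exact hsep [c] _ (IsLyndon.letter c) (hq (m j)) h1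

end Overlap

/-! ### Sandwich sets -/

section Commutators

variable {G : Type*} [Group G]

/-- The conjugate `a ^ g = g⁻¹ * a * g`. -/
def rconj (a g : G) : G := g⁻¹ * a * g

/-- The commutator `[a, b] = a⁻¹ * b⁻¹ * a * b`. -/
def rcomm (a b : G) : G := a⁻¹ * b⁻¹ * a * b

theorem rconj_one (a : G) : rconj a 1 = a := by simp [rconj]

theorem one_rconj (g : G) : rconj 1 g = 1 := by simp [rconj]

theorem rconj_rconj (a g h : G) : rconj (rconj a g) h = rconj a (g * h) := by
  simp [rconj, mul_assoc]

theorem mul_rconj (a b g : G) : rconj (a * b) g = rconj a g * rconj b g := by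
  simp [rconj, mul_assoc]

theorem inv_rconj (a g : G) : rconj a⁻¹ g = (rconj a g)⁻¹ := by simp [rconj, mul_assoc]

theorem rcomm_rconj (a b g : G) : rconj (rcomm a b) g = rcomm (rconj a g) (rconj b g) := by
  simp [rconj, rcomm, mul_assoc]

theorem rcomm_inv (a b : G) : (rcomm a b)⁻¹ = rcomm b a := by simp [rcomm, mul_assoc]

theorem rcomm_eq_inv_mul_rconj (a b : G) : rcomm a b = a⁻¹ * rconj a b := by
  simp [rconj, rcomm, mul_assoc]

theorem rcomm_eq_rconj_inv_mul (a b : G) : rcomm a b = (rconj b a)⁻¹ * b := by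
  simp [rconj, rcomm, mul_assoc]

theorem rcomm_inv_right (a b : G) : rcomm a b⁻¹ = rconj b a * b⁻¹ := by
  simp [rconj, rcomm, mul_assoc]

theorem mul_rcomm (a b : G) : a * rcomm a b = rconj a b := by simp [rconj, rcomm, mul_assoc]

theorem rcomm_eq_one_iff {a b : G} : rcomm a b = 1 ↔ Commute a b := by
  rw [rcomm_eq_inv_mul_rconj, inv_mul_eq_one, rconj, mul_assoc, eq_inv_mul_iff_mul_eq]
  exact eq_comm

theorem rconj_eq_of_commute {a g : G} (h : Commute a g) : rconj a g = a := by
  rw [← mul_rcomm, rcomm_eq_one_iff.2 h, mul_one]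

theorem commute_rconj_iff {a b g : G} : Commute a (rconj b g) ↔ Commute (rconj a g⁻¹) b := by
  simp only [rconj, Commute, SemiconjBy, inv_inv]
  constructor <;> intro h
  · have := congrArg (fun t => g * t * g⁻¹) h
    simpa [mul_assoc] using this
  · have := congrArg (fun t => g⁻¹ * t * g) h
    simpa [mul_assoc] using this

theorem commute_rconj_rconj_iff {a b g : G} :
    Commute (rconj a g) (rconj b g) ↔ Commute a b := by
  rw [commute_rconj_iff, rconj_rconj, mul_inv_cancel, rconj_one]

theorem rcomm_mul_right (a b c : G) : rcomm a (b * c) = rcomm a c * rconj (rcomm a b) c := by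
  simp [rconj, rcomm, mul_assoc]

theorem rcomm_mul_left (a b c : G) : rcomm (a * b) c = rconj (rcomm a c) b * rcomm b c := by
  simp [rconj, rcomm, mul_assoc]

theorem rconj_mul_of_commute {c p q : G} (h : Commute (rcomm c p) q) :
    rconj c (p * q) = rconj c q * (c⁻¹ * rconj c p) := by
  rw [← mul_rcomm, rcomm_mul_right, rconj_eq_of_commute h, ← mul_assoc, mul_rcomm,
    rcomm_eq_inv_mul_rconj]

theorem rcomm_inv_left_of {a b : G} (h : Commute (rcomm a b) a) : rcomm a⁻¹ b = (rcomm a b)⁻¹ := by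
  have : rcomm a⁻¹ b = rconj (rcomm a b)⁻¹ a⁻¹ := by simp [rcomm, rconj, mul_assoc]
  rw [this, rconj_eq_of_commute h.inv_left.inv_right]

/-- The subgroup generated by the conjugates of `a` under elements of `S`. -/
def conjSpan (S : Set G) (a : G) : Subgroup G := Subgroup.closure (rconj a '' S)

theorem rconj_mem_conjSpan {S : Set G} {x : G} (a : G) (hx : x ∈ S) : rconj a x ∈ conjSpan S a :=
  Subgroup.subset_closure ⟨x, hx, rfl⟩

theorem commute_of_mem_conjSpan {S : Set G} {a : G}
    (h : ∀ x ∈ S, ∀ y ∈ S, Commute (rconj a x) (rconj a y)) {x y : G}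
    (hx : x ∈ conjSpan S a) (hy : y ∈ conjSpan S a) : Commute x y := by
  have h1 : conjSpan S a ≤ Subgroup.centralizer (rconj a '' S) := by
    rw [conjSpan, Subgroup.closure_le]
    rintro _ ⟨x, hx, rfl⟩
    rw [SetLike.mem_coe, Subgroup.mem_centralizer_iff]
    rintro _ ⟨y, hy, rfl⟩
    exact h y hy x hx
  have h2 : conjSpan S a ≤ Subgroup.centralizer (conjSpan S a : Set G) := by
    conv_lhs => rw [conjSpan]
    rw [Subgroup.closure_le]
    intro z hz
    rw [SetLike.mem_coe, Subgroup.mem_centralizer_iff]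
    intro t ht
    exact (Subgroup.mem_centralizer_iff.1 (h1 ht) z hz).symm
  exact Subgroup.mem_centralizer_iff.1 (h2 hy) x hx

/-- A normal, symmetric set containing the identity such that the conjugates of each element under
the others commute with one another. -/
structure IsSandwich (S : Set G) : Prop where
  one_mem : 1 ∈ S
  rconj_mem : ∀ a ∈ S, ∀ g, rconj a g ∈ S
  inv_mem : ∀ a ∈ S, a⁻¹ ∈ S
  commute : ∀ a ∈ S, ∀ x ∈ S, ∀ y ∈ S, Commute (rconj a x) (rconj a y)

namespace IsSandwich

variable {S : Set G} {a b c d : G}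

theorem self_mem_conjSpan (hS : IsSandwich S) (a : G) : a ∈ conjSpan S a := by
  simpa [rconj_one] using rconj_mem_conjSpan a hS.one_mem

theorem commute_of_mem (hS : IsSandwich S) (ha : a ∈ S) {x y : G}
    (hx : x ∈ conjSpan S a) (hy : y ∈ conjSpan S a) : Commute x y :=
  commute_of_mem_conjSpan (hS.commute a ha) hx hy

theorem rcomm_mem_left (hS : IsSandwich S) (a : G) {x : G} (hx : rconj a x ∈ conjSpan S a) :
    rcomm a x ∈ conjSpan S a := by
  rw [rcomm_eq_inv_mul_rconj]
  exact mul_mem (Subgroup.inv_mem _ (hS.self_mem_conjSpan a)) hx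

theorem rcomm_mem_right (hS : IsSandwich S) (a : G) {x : G} (hx : rconj a x ∈ conjSpan S a) :
    rcomm x a ∈ conjSpan S a := by
  rw [← rcomm_inv]
  exact Subgroup.inv_mem _ (hS.rcomm_mem_left a hx)

theorem rcomm_inv_mem (hS : IsSandwich S) (a : G) {x : G} (hx : rconj a x ∈ conjSpan S a) :
    rcomm x a⁻¹ ∈ conjSpan S a := by
  rw [rcomm_inv_right]
  exact mul_mem hx (Subgroup.inv_mem _ (hS.self_mem_conjSpan a))

/-- Conjugating by a commutator of elements of `S` does not leave `conjSpan S c`, as soon as the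
conjugate of `a` by `c` lies in `conjSpan S a`. -/
theorem rconj_rcomm_mem_of (hS : IsSandwich S) (ha : a ∈ S) (hb : b ∈ S) (hc : rconj a c ∈ conjSpan S a) :
    rconj c (rcomm a b) ∈ conjSpan S c := by
  -- Since `[a,b] = a⁻¹ a^b` and `[c,a⁻¹]` commutes with `a^b`, the conjugate is `c^(a^b) c⁻¹
  -- c^(a⁻¹)`.
  rw [rcomm_eq_inv_mul_rconj, rconj_mul_of_commute]
  · exact mul_mem (rconj_mem_conjSpan c (hS.rconj_mem a ha b))
      (mul_mem (Subgroup.inv_mem _ (hS.self_mem_conjSpan c)) (rconj_mem_conjSpan c (hS.inv_mem a ha)))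
  · exact hS.commute_of_mem ha (hS.rcomm_inv_mem a hc) (rconj_mem_conjSpan a hb)

theorem rconj_rcomm_mem (hS : IsSandwich S) (ha : a ∈ S) (hb : b ∈ S) (hc : c ∈ S) :
    rconj c (rcomm a b) ∈ conjSpan S c :=
  hS.rconj_rcomm_mem_of ha hb (rconj_mem_conjSpan a hc)

theorem commute_rcomm_left (hS : IsSandwich S) (ha : a ∈ S) (hb : b ∈ S) : Commute (rcomm a b) a :=
  hS.commute_of_mem ha (hS.rcomm_mem_left a (rconj_mem_conjSpan a hb)) (hS.self_mem_conjSpan a)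

theorem commute_rcomm_right (hS : IsSandwich S) (ha : a ∈ S) (hb : b ∈ S) : Commute (rcomm a b) b :=
  hS.commute_of_mem hb (hS.rcomm_mem_right b (rconj_mem_conjSpan b ha)) (hS.self_mem_conjSpan b)

theorem commute_triple_left (hS : IsSandwich S) (ha : a ∈ S) (hb : b ∈ S) (hc : c ∈ S) :
    Commute (rcomm (rcomm a b) c) a := by
  have h1 := hS.commute_rcomm_left ha hb
  have h2 : Commute (rconj (rcomm a b) c) a := by
    rw [rcomm_eq_inv_mul_rconj, mul_rconj, inv_rconj]
    refine Commute.mul_left (Commute.inv_left ?_) ?_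
    · exact hS.commute_of_mem ha (rconj_mem_conjSpan a hc) (hS.self_mem_conjSpan a)
    · rw [Commute.symm_iff, commute_rconj_iff]
      exact hS.commute a ha _ (hS.inv_mem c hc) b hb
  rw [rcomm_eq_inv_mul_rconj]
  exact h1.inv_left.mul_left h2

/-- Exchange `a` and `b`: `[[b,a],c]` commutes with both, hence with `[b,a]`, so inverting the inner
commutator merely inverts the whole. -/
theorem commute_triple_mid (hS : IsSandwich S) (ha : a ∈ S) (hb : b ∈ S) (hc : c ∈ S) :
    Commute (rcomm (rcomm a b) c) b := by
  have h := hS.commute_triple_left hb ha hc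
  have h1 := hS.commute_rcomm_left hb ha
  have h2 : Commute (rcomm (rcomm b a) c) a := by
    have h1 := hS.commute_rcomm_right hb ha
    have h2 : Commute (rconj (rcomm b a) c) a := by
      rw [rcomm_eq_rconj_inv_mul, mul_rconj, inv_rconj, rconj_rconj]
      refine Commute.mul_left (Commute.inv_left ?_) ?_
      · rw [← rconj_rconj, Commute.symm_iff, commute_rconj_iff]
        exact hS.commute a ha _ (hS.inv_mem c hc) b hb
      · exact hS.commute_of_mem ha (rconj_mem_conjSpan a hc) (hS.self_mem_conjSpan a)
    rw [rcomm_eq_inv_mul_rconj]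
    exact h1.inv_left.mul_left h2
  have h3 : Commute (rcomm (rcomm b a) c) (rcomm b a) := by
    rw [show rcomm b a = b⁻¹ * a⁻¹ * b * a from rfl]
    exact ((h.inv_right.mul_right h2.inv_right).mul_right h).mul_right h2
  rw [← rcomm_inv b a, rcomm_inv_left_of h3]
  exact h.inv_left

theorem commute_triple_self (hS : IsSandwich S) (ha : a ∈ S) (hb : b ∈ S) (hc : c ∈ S) :
    Commute (rcomm (rcomm a b) c) (rcomm a b) := by
  have h1 := hS.commute_triple_left ha hb hc
  have h2 := hS.commute_triple_mid ha hb hc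
  exact ((h1.inv_right.mul_right h2.inv_right).mul_right h1).mul_right h2

theorem commute_triple_right (hS : IsSandwich S) (ha : a ∈ S) (hb : b ∈ S) (hc : c ∈ S) :
    Commute (rcomm (rcomm a b) c) c :=
  hS.commute_of_mem hc (hS.rcomm_mem_right c (hS.rconj_rcomm_mem ha hb hc))
    (hS.self_mem_conjSpan c)

/-- The Hall–Witt identity for three elements of a sandwich set. -/
theorem rcomm_rcomm_eq_mul (hS : IsSandwich S) (ha : a ∈ S) (hb : b ∈ S) (hc : c ∈ S) :
    rcomm (rcomm a b) c = rcomm a (rcomm b c) * rcomm (rcomm a c) b := by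
  have hbc : rcomm a (rcomm b c) = (rcomm (rcomm b c) a)⁻¹ := (rcomm_inv _ _).symm
  have h1 : Commute (rcomm a (rcomm b c)) (rcomm a b) := by
    have ha' : Commute (rcomm a (rcomm b c)) a := by
      rw [hbc]; exact (hS.commute_triple_right hb hc ha).inv_left
    have hb' : Commute (rcomm a (rcomm b c)) b := by
      rw [hbc]; exact (hS.commute_triple_left hb hc ha).inv_left
    exact ((ha'.inv_right.mul_right hb'.inv_right).mul_right ha').mul_right hb'
  have hA : Commute (rcomm a b) (rcomm a c) :=
    hS.commute_of_mem ha (hS.rcomm_mem_left a (rconj_mem_conjSpan a hb))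
      (hS.rcomm_mem_left a (rconj_mem_conjSpan a hc))
  have hB : Commute (rcomm a b) (rcomm b c) :=
    hS.commute_of_mem hb (hS.rcomm_mem_right b (rconj_mem_conjSpan b ha))
      (hS.rcomm_mem_left b (rconj_mem_conjSpan b hc))
  have hAB : Commute (rcomm a c) (rcomm b c) :=
    hS.commute_of_mem hc (hS.rcomm_mem_right c (rconj_mem_conjSpan c ha))
      (hS.rcomm_mem_right c (rconj_mem_conjSpan c hb))
  have h2 : Commute (rcomm (rcomm a c) b) (rcomm b c) := by
    have hb' := hS.commute_triple_right ha hc hb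
    have hc' := hS.commute_triple_mid ha hc hb
    exact ((hb'.inv_right.mul_right hc'.inv_right).mul_right hb').mul_right hc'
  have h3 : Commute (rcomm a (rcomm b c)) (rcomm a c) := by
    rw [hbc]
    have ha' := (hS.commute_triple_right hb hc ha).inv_left
    have hc' := (hS.commute_triple_mid hb hc ha).inv_left
    exact ((ha'.inv_right.mul_right hc'.inv_right).mul_right ha').mul_right hc'
  -- Expand `[a,b]^c = [a[a,c], b[b,c]]`; the commutations above remove every conjugation and the
  -- factor `[[a,c],[b,c]]`.
  have key : rconj (rcomm a b) c
      = rcomm a (rcomm b c) * rcomm a b * rcomm (rcomm a c) b := by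
    rw [rcomm_rconj, ← mul_rcomm a c, ← mul_rcomm b c, rcomm_mul_left, rcomm_mul_right,
      rcomm_mul_right, rcomm_eq_one_iff.2 hAB, one_mul, rconj_eq_of_commute hB,
      rconj_eq_of_commute h2, rconj_eq_of_commute (h3.mul_left hA)]
  rw [rcomm_eq_inv_mul_rconj, key, h1.eq, mul_assoc, inv_mul_cancel_left]

/-- Split `[a,[b,c]] = [a,b^c][a,b⁻¹]` and `[[a,b],d] = [a,[b,d]][[a,d],b]`. What remains is a
comparison of conjugates of `a`, and then of conjugates of `b`. -/
theorem commute_triple_rcomm_rcomm (hS : IsSandwich S) (ha : a ∈ S) (hb : b ∈ S) (hc : c ∈ S) (hd : d ∈ S) :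
    Commute (rcomm (rcomm a b) d) (rcomm a (rcomm b c)) := by
  have hbc := hS.rconj_mem b hb c
  have ea := hS.commute_triple_left ha hb hd
  have eb := hS.commute_triple_mid ha hb hd
  have hα : rcomm a (rcomm b c) = rcomm a (rconj b c) * rcomm a b⁻¹ := by
    rw [rcomm_eq_inv_mul_rconj b c, rcomm_mul_right, rconj_eq_of_commute (a := rcomm a b⁻¹)]
    exact hS.commute_of_mem hb (hS.rcomm_inv_mem b (rconj_mem_conjSpan b ha))
      (rconj_mem_conjSpan b hc)
  have e2 : Commute (rcomm (rcomm a b) d) (rcomm a b⁻¹) :=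
    ((ea.inv_right.mul_right eb.inv_right.inv_right).mul_right ea).mul_right eb.inv_right
  rw [hα]
  refine Commute.mul_right ?_ e2
  rw [hS.rcomm_rcomm_eq_mul ha hb hd]
  refine Commute.mul_left ?_ ?_
  · exact hS.commute_of_mem ha (hS.rcomm_mem_left a (hS.rconj_rcomm_mem hb hd ha))
      (hS.rcomm_mem_left a (rconj_mem_conjSpan a hbc))
  · have hD := hS.rconj_rcomm_mem ha hd hb
    have hself := hS.self_mem_conjSpan b
    have hbc' := rconj_mem_conjSpan b hc
    rw [rcomm_eq_rconj_inv_mul (rcomm a d) b, rcomm_eq_rconj_inv_mul a (rconj b c)]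
    have t1 : Commute b (rconj b c) := hS.commute_of_mem hb hself hbc'
    have t2 : Commute (rconj b (rcomm a d)) (rconj b c) := hS.commute_of_mem hb hD hbc'
    have t3 : Commute b (rconj (rconj b c) a) := by
      rw [commute_rconj_iff]
      exact hS.commute b hb _ (hS.inv_mem a ha) c hc
    have t4 : Commute (rconj b (rcomm a d)) (rconj (rconj b c) a) := by
      -- Conjugation by `a⁻¹` fixes `[b,[a,d]]`, which reduces the claim to conjugates of `b` under
      -- `S`.
      have hcen : Commute (rcomm b (rcomm a d)) a⁻¹ := by
        rw [← rcomm_inv]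
        exact (hS.commute_triple_left ha hd hb).inv_left.inv_right
      rw [commute_rconj_iff, ← mul_rcomm b (rcomm a d), mul_rconj, rconj_eq_of_commute hcen]
      exact (hS.commute b hb _ (hS.inv_mem a ha) c hc).mul_left
        (hS.commute_of_mem hb (hS.rcomm_mem_left b hD) hbc')
    exact (t4.inv_left.mul_left t3).inv_right.mul_right (t2.inv_left.mul_left t1)

theorem commute_triple_triple (hS : IsSandwich S) (ha : a ∈ S) (hb : b ∈ S) (hc : c ∈ S) (hd : d ∈ S) :
    Commute (rcomm (rcomm a b) d) (rcomm (rcomm a b) c) := by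
  rw [hS.rcomm_rcomm_eq_mul ha hb hc]
  refine (hS.commute_triple_rcomm_rcomm ha hb hc hd).mul_right ?_
  have h := hS.commute_triple_rcomm_rcomm hb ha hc hd
  rw [← rcomm_inv b a, rcomm_inv_left_of (hS.commute_triple_self hb ha hd),
    ← rcomm_inv b (rcomm a c)]
  exact h.inv_left.inv_right

theorem commute_rconj_rcomm (hS : IsSandwich S) (ha : a ∈ S) (hb : b ∈ S) (hc : c ∈ S) (hd : d ∈ S) :
    Commute (rconj (rcomm a b) c) (rconj (rcomm a b) d) := by
  rw [← mul_rcomm _ c, ← mul_rcomm _ d]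
  refine Commute.mul_left ((Commute.refl _).mul_right ?_) (Commute.mul_right ?_ ?_)
  · exact (hS.commute_triple_self ha hb hd).symm
  · exact hS.commute_triple_self ha hb hc
  · exact hS.commute_triple_triple ha hb hd hc

/-- Adding all commutators to a sandwich set gives a sandwich set. -/
theorem union_commutators (hS : IsSandwich S) : IsSandwich (S ∪ Set.image2 rcomm S S) where
  one_mem := Or.inl hS.one_mem
  rconj_mem := by
    rintro _ (ha | ⟨a, ha, b, hb, rfl⟩) g
    · exact Or.inl (hS.rconj_mem _ ha g)
    · exact Or.inr ⟨_, hS.rconj_mem a ha g, _, hS.rconj_mem b hb g, (rcomm_rconj a b g).symm⟩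
  inv_mem := by
    rintro _ (ha | ⟨a, ha, b, hb, rfl⟩)
    · exact Or.inl (hS.inv_mem _ ha)
    · exact Or.inr ⟨b, hb, a, ha, (rcomm_inv a b).symm⟩
  commute := by
    -- Conjugators in `S` suffice: the second hypothesis puts the conjugates of `u` by commutators
    -- into `conjSpan S u`, which is abelian by the first.
    have key : ∀ u, (∀ c ∈ S, ∀ d ∈ S, Commute (rconj u c) (rconj u d)) →
        (∀ c ∈ S, rconj c u ∈ conjSpan S c) → ∀ x ∈ S ∪ Set.image2 rcomm S S,
        ∀ y ∈ S ∪ Set.image2 rcomm S S, Commute (rconj u x) (rconj u y) := by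
      intro u hu hu' x hx y hy
      have hmem : ∀ x ∈ S ∪ Set.image2 rcomm S S, rconj u x ∈ conjSpan S u := by
        rintro _ (hx | ⟨c, hc, d, hd, rfl⟩)
        · exact rconj_mem_conjSpan u hx
        · exact hS.rconj_rcomm_mem_of hc hd (hu' c hc)
      exact commute_of_mem_conjSpan hu (hmem x hx) (hmem y hy)
    rintro _ (ha | ⟨a, ha, b, hb, rfl⟩)
    · exact key _ (hS.commute _ ha) fun c _ => rconj_mem_conjSpan c ha
    · exact key _ (fun c hc d hd => hS.commute_rconj_rcomm ha hb hc hd)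
        fun c hc => hS.rconj_rcomm_mem ha hb hc

end IsSandwich

/-- Every sandwich set is contained in a sandwich set that is closed under commutators. -/
theorem IsSandwich.exists_rcomm_closed {S : Set G} (hS : IsSandwich S) :
    ∃ T, S ⊆ T ∧ IsSandwich T ∧ ∀ a ∈ T, ∀ b ∈ T, rcomm a b ∈ T := by
  let f : Set G → Set G := fun S => S ∪ Set.image2 rcomm S S
  have hf : ∀ n, IsSandwich (f^[n] S) := by
    intro n
    induction n with
    | zero => exact hS
    | succ n ih => rw [Function.iterate_succ_apply']; exact ih.union_commutators
  have hmono : Monotone fun n => f^[n] S := monotone_nat_of_le_succ fun n => by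
    rw [Function.iterate_succ_apply']; exact Set.subset_union_left
  have hlift : ∀ {a}, a ∈ ⋃ n, f^[n] S → ∃ n, ∀ m ≥ n, a ∈ f^[m] S := fun ha => by
    obtain ⟨n, hn⟩ := Set.mem_iUnion.1 ha
    exact ⟨n, fun m hm => hmono hm hn⟩
  refine ⟨⋃ n, f^[n] S, Set.subset_iUnion (fun n => f^[n] S) 0, ⟨?_, ?_, ?_, ?_⟩, ?_⟩
  · exact Set.mem_iUnion.2 ⟨0, hS.one_mem⟩
  · intro a ha g
    obtain ⟨n, hn⟩ := hlift ha
    exact Set.mem_iUnion.2 ⟨n, (hf n).rconj_mem a (hn n le_rfl) g⟩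
  · intro a ha
    obtain ⟨n, hn⟩ := hlift ha
    exact Set.mem_iUnion.2 ⟨n, (hf n).inv_mem a (hn n le_rfl)⟩
  · intro a ha x hx y hy
    obtain ⟨n, hn⟩ := hlift ha
    obtain ⟨m, hm⟩ := hlift hx
    obtain ⟨k, hk⟩ := hlift hy
    exact (hf (n + m + k)).commute a (hn _ (by omega)) x (hm _ (by omega)) y (hk _ (by omega))
  · intro a ha b hb
    obtain ⟨n, hn⟩ := hlift ha
    obtain ⟨m, hm⟩ := hlift hb
    refine Set.mem_iUnion.2 ⟨n + m + 1, ?_⟩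
    rw [Function.iterate_succ_apply']
    exact Or.inr ⟨a, hn _ (by omega), b, hm _ (by omega), rfl⟩

end Commutators

/-! ### Greedy words and commutator-closed sandwich sets -/

section Greedy

variable {G : Type*} [Group G] {α : Type*}

theorem LexBelow.trans [LinearOrder α] {u v w : List α} (h1 : LexBelow u v) (h2 : LexBelow v w) :
    LexBelow u w := by
  obtain ⟨r, a, b, u', v', rfl, rfl, hab⟩ := h1
  obtain ⟨s, c, d, v'', w', h, rfl, hcd⟩ := h2
  rcases List.append_eq_append_iff.1 h with ⟨t, rfl, ht⟩ | ⟨t, rfl, ht⟩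
  · rcases t with _ | ⟨e, t⟩
    · obtain ⟨rfl, -⟩ := List.cons.inj ht
      exact ⟨r, a, d, u', w', rfl, by simp, hab.trans hcd⟩
    · obtain ⟨rfl, -⟩ := List.cons.inj ht
      exact ⟨r, a, b, u', t ++ d :: w', rfl, by simp, hab⟩
  · rcases t with _ | ⟨e, t⟩
    · obtain ⟨rfl, -⟩ := List.cons.inj ht
      exact ⟨s, a, d, u', w', by simp, rfl, hab.trans hcd⟩
    · obtain ⟨rfl, -⟩ := List.cons.inj ht
      exact ⟨s, c, d, t ++ a :: u', w', by simp, rfl, hcd⟩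

theorem LexBelow.of_append [LinearOrder α] {w p q : List α} (h : LexBelow w (p ++ q)) :
    LexBelow w p ∨ ∃ w', w = p ++ w' ∧ LexBelow w' q := by
  obtain ⟨r, a, b, w', u', rfl, h, hab⟩ := h
  rcases List.append_eq_append_iff.1 h with ⟨t, rfl, ht⟩ | ⟨t, rfl, ht⟩
  · exact Or.inr ⟨t ++ a :: w', by simp, t, a, b, w', u', rfl, ht, hab⟩
  · rcases t with _ | ⟨e, t⟩
    · exact Or.inr ⟨a :: w', by simp, [], a, b, w', u', rfl, ht.symm, hab⟩
    · obtain ⟨rfl, -⟩ := List.cons.inj ht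
      exact Or.inl ⟨r, a, b, w', t, rfl, rfl, hab⟩

/-- The left-normed commutator `[g, x a₁, …, x aₙ]`. -/
def iterComm (x : α → G) (g : G) (w : List α) : G := w.foldl (fun h a => rcomm h (x a)) g

theorem iterComm_append (x : α → G) (g : G) (u v : List α) :
    iterComm x g (u ++ v) = iterComm x (iterComm x g u) v := List.foldl_append

theorem iterComm_one (x : α → G) (w : List α) : iterComm x 1 w = 1 := by
  induction w with
  | nil => rfl
  | cons a w ih =>
    have : rcomm 1 (x a) = 1 := rcomm_eq_one_iff.2 (Commute.one_left _)
    rw [iterComm, List.foldl_cons, this]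
    exact ih

variable {T : Set G}

theorem iterComm_mem (hcl : ∀ a ∈ T, ∀ b ∈ T, rcomm a b ∈ T) {x : α → G} (hx : ∀ i, x i ∈ T)
    {g : G} (hg : g ∈ T) (w : List α) : iterComm x g w ∈ T := by
  induction w generalizing g with
  | nil => exact hg
  | cons a w ih => exact ih (hcl g hg _ (hx a))

/-- The term `[[g,q],p]` of the Hall–Witt identity vanishes. -/
theorem IsSandwich.rcomm_rcomm_of_commute (hT : IsSandwich T) {g p q : G} (hg : g ∈ T) (hp : p ∈ T)
    (hq : q ∈ T) (h : Commute g q) : rcomm g (rcomm p q) = rcomm (rcomm g p) q := by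
  rw [hT.rcomm_rcomm_eq_mul hg hp hq, rcomm_eq_one_iff.2 h,
    rcomm_eq_one_iff.2 (Commute.one_left p), mul_one]

variable [LinearOrder α]

/-- In the left-normed commutator `[g, x a₁, …, x aₙ]`, no letter can be replaced by a larger one
without killing the commutator up to that letter. -/
def Greedy (x : α → G) : G → List α → Prop
  | _, [] => True
  | g, a :: w => (∀ b, a < b → Commute g (x b)) ∧ Greedy x (rcomm g (x a)) w

theorem greedy_append {x : α → G} {g : G} {u v : List α} :
    Greedy x g (u ++ v) ↔ Greedy x g u ∧ Greedy x (iterComm x g u) v := by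
  induction u generalizing g with
  | nil => simp [Greedy, iterComm]
  | cons a u ih => simp [Greedy, iterComm, ih, and_assoc]

/-- The bracketing of a Lyndon word acts on greedy words as the word itself. -/
theorem IsLyndon.exists_bracket (hT : IsSandwich T) (hcl : ∀ a ∈ T, ∀ b ∈ T, rcomm a b ∈ T)
    {x : α → G} (hx : ∀ i, x i ∈ T) {u : List α} (hu : IsLyndon u) :
    ∃ c ∈ T, (∀ g ∈ T, ∀ w, Greedy x g w → LexBelow w u → Commute g c) ∧
      ∀ g ∈ T, Greedy x g u → rcomm g c = iterComm x g u := by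
  induction hu with
  | letter a =>
    refine ⟨x a, hx a, ?_, fun _ _ _ => rfl⟩
    rintro g - _ hw ⟨r, a', b, w', u', rfl, h, hab⟩
    rcases r with _ | ⟨e, r⟩
    · obtain ⟨rfl, -⟩ := List.cons.inj h
      exact hw.1 _ hab
    · simp at h
  | @append p q _ _ hpq ihp ihq =>
    obtain ⟨c, hc, hc1, hc2⟩ := ihp
    obtain ⟨e, he, he1, he2⟩ := ihq
    refine ⟨rcomm c e, hcl c hc e he, fun g hg w hw hlt => ?_, fun g hg hgr => ?_⟩
    -- A word below `p ++ q` is below `q`, so `g` commutes with `e` and bracketing by `[c,e]` means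
    -- bracketing by `c`, then by `e`.
    · have hge : Commute g e := he1 g hg w hw (hlt.trans hpq)
      rw [← rcomm_eq_one_iff, hT.rcomm_rcomm_of_commute hg hc he hge]
      rcases hlt.of_append with h | ⟨w', rfl, h⟩
      · rw [rcomm_eq_one_iff.2 (hc1 g hg w hw h), rcomm_eq_one_iff]
        exact Commute.one_left e
      · obtain ⟨h1, h2⟩ := greedy_append.1 hw
        rw [hc2 g hg h1, rcomm_eq_one_iff]
        exact he1 _ (iterComm_mem hcl hx hg p) w' h2 h
    · have hge : Commute g e := he1 g hg _ hgr hpq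
      obtain ⟨h1, h2⟩ := greedy_append.1 hgr
      rw [hT.rcomm_rcomm_of_commute hg hc he hge, hc2 g hg h1, iterComm_append,
        he2 _ (iterComm_mem hcl hx hg p) h2]

/-- A commutator-closed sandwich set is trivial if only the identity commutes with a given finite
family of its members. -/
theorem IsSandwich.eq_one_of_commute [Finite α] (hT : IsSandwich T)
    (hcl : ∀ a ∈ T, ∀ b ∈ T, rcomm a b ∈ T) {x : α → G} (hx : ∀ i, x i ∈ T)
    (htriv : ∀ g ∈ T, (∀ i, Commute g (x i)) → g = 1) {g : G} (hg : g ∈ T) : g = 1 := by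
  by_contra hg1
  let L : Set (List α) := {w | ∃ g ∈ T, Greedy x g w ∧ iterComm x g w ≠ 1}
  have hL : FactorClosed L := by
    rintro u v w ⟨g, hg, hgr, hne⟩
    rw [greedy_append, greedy_append] at hgr
    rw [iterComm_append, iterComm_append] at hne
    refine ⟨iterComm x g u, iterComm_mem hcl hx hg u, hgr.1.2, fun h => hne ?_⟩
    rw [h, iterComm_one]
  have hL' : HasAllLengths L := by
    have key : ∀ n, ∀ g ∈ T, g ≠ 1 → ∃ w, Greedy x g w ∧ iterComm x g w ≠ 1 ∧ w.length = n := by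
      intro n
      induction n with
      | zero => exact fun g _ h => ⟨[], trivial, h, rfl⟩
      | succ n ih =>
        intro g hg h
        have hex : ∃ i, ¬ Commute g (x i) := by
          by_contra! hcon
          exact h (htriv g hg hcon)
        obtain ⟨a, ha, hmax⟩ :=
          Set.exists_max_image {i | ¬ Commute g (x i)} id (Set.toFinite _) hex
        obtain ⟨w, hw1, hw2, hw3⟩ := ih (rcomm g (x a)) (hcl g hg _ (hx a))
          fun h => ha (rcomm_eq_one_iff.1 h)
        refine ⟨a :: w, ⟨fun b hb => ?_, hw1⟩, hw2, by simp [hw3]⟩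
        by_contra hcon
        exact absurd hb (not_lt.2 (hmax b hcon))
    intro n
    obtain ⟨w, h1, h2, h3⟩ := key n g hg hg1
    exact ⟨w, ⟨g, hg, h1, h2⟩, h3⟩
  obtain ⟨u, hu, h⟩ := exists_isLyndon_repetition L hL hL'
  obtain ⟨c, hc, -, hc'⟩ := hu.exists_bracket hT hcl hx
  rcases h with ⟨g, hg, hgr, hne⟩ | ⟨v, hv, g, hg, hgr, hne⟩
  · obtain ⟨h1, h2⟩ := greedy_append.1 hgr
    rw [iterComm_append, ← hc' _ (iterComm_mem hcl hx hg u) h2, ← hc' g hg h1] at hne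
    exact hne (rcomm_eq_one_iff.2 (hT.commute_rcomm_right hg hc))
  · obtain ⟨e, he, -, he'⟩ := hv.exists_bracket hT hcl hx
    rw [greedy_append, greedy_append, iterComm_append] at hgr
    obtain ⟨⟨h1, h2⟩, h3⟩ := hgr
    have hgu := iterComm_mem hcl hx hg u
    rw [iterComm_append, iterComm_append, ← hc' _ (iterComm_mem hcl hx hgu v) h3,
      ← he' _ hgu h2, ← hc' g hg h1] at hne
    exact hne (rcomm_eq_one_iff.2 (hT.commute_triple_mid hg hc he))

end Greedy

/-! ### Nilpotency -/

section Nilpotent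

open scoped commutatorElement

variable {G : Type*} [Group G]

theorem map_rconj {K : Type*} [Group K] (f : G →* K) (a g : G) :
    f (rconj a g) = rconj (f a) (f g) := by simp [rconj]

theorem IsSandwich.image {K : Type*} [Group K] {S : Set G} (hS : IsSandwich S) (f : G →* K)
    (hf : Function.Surjective f) : IsSandwich (f '' S) where
  one_mem := ⟨1, hS.one_mem, map_one f⟩
  rconj_mem := by
    rintro _ ⟨a, ha, rfl⟩ g
    obtain ⟨g, rfl⟩ := hf g
    exact ⟨_, hS.rconj_mem a ha g, map_rconj f a g⟩
  inv_mem := by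
    rintro _ ⟨a, ha, rfl⟩
    exact ⟨_, hS.inv_mem a ha, map_inv f a⟩
  commute := by
    rintro _ ⟨a, ha, rfl⟩ _ ⟨x, hx, rfl⟩ _ ⟨y, hy, rfl⟩
    rw [← map_rconj, ← map_rconj]
    exact (hS.commute a ha x hx y hy).map f

theorem directed_upperCentralSeries :
    Directed (· ≤ ·) (Subgroup.upperCentralSeries G) :=
  (Subgroup.upperCentralSeries_mono G).directed_le

/-- If a finite set generates `G`, then any element commuting with it modulo the union of the upper
central series lies in that union. -/
theorem mem_iSup_upperCentralSeries_of_finset {F : Finset G}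
    (hF : Subgroup.closure (F : Set G) = ⊤) {g : G}
    (h : ∀ x ∈ F, ⁅g, x⁆ ∈ ⨆ n, Subgroup.upperCentralSeries G n) :
    g ∈ ⨆ n, Subgroup.upperCentralSeries G n := by
  simp only [Subgroup.mem_iSup_of_directed directed_upperCentralSeries] at h ⊢
  choose! n hn using h
  let N := F.sup n
  have hN : ∀ x ∈ F, ⁅g, x⁆ ∈ Subgroup.upperCentralSeries G N := fun x hx =>
    Subgroup.upperCentralSeries_mono G (Finset.le_sup hx) (hn x hx)
  refine ⟨N + 1, Subgroup.mem_upperCentralSeries_succ_iff.2 fun y => ?_⟩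
  have hy : y ∈ Subgroup.closure (F : Set G) := hF ▸ Subgroup.mem_top y
  have key : ∀ y, ⁅g, y⁆ ∈ Subgroup.upperCentralSeries G N ↔
      Commute (QuotientGroup.mk' (Subgroup.upperCentralSeries G N) g)
        (QuotientGroup.mk' (Subgroup.upperCentralSeries G N) y) := by
    intro y
    rw [← commutatorElement_eq_one_iff_commute, ← map_commutatorElement, ← MonoidHom.mem_ker,
      QuotientGroup.ker_mk']
  induction hy using Subgroup.closure_induction with
  | mem y hy => exact hN y hy
  | one => rw [key, map_one]; exact Commute.one_right _
  | mul a b _ _ ha hb => rw [key] at *; rw [map_mul]; exact ha.mul_right hb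
  | inv a _ ha => rw [key] at *; rw [map_inv]; exact ha.inv_right

/-- Modulo the union of the upper central series, an element commuting with the generators is
trivial, which is what `IsSandwich.eq_one_of_commute` requires. -/
theorem IsSandwich.isNilpotent {S : Set G} (hS : IsSandwich S) (F : Finset G)
    (hFS : (F : Set G) ⊆ S) (hF : Subgroup.closure (F : Set G) = ⊤) : Group.IsNilpotent G := by
  let Z : Subgroup G := ⨆ n, Subgroup.upperCentralSeries G n
  have hZ : Z.Normal := Subgroup.iSup_normal _
  let π := QuotientGroup.mk' Z
  have hπ : Function.Surjective π := QuotientGroup.mk'_surjective Z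
  have hker : ∀ g, π g = 1 ↔ g ∈ Z := fun g => by
    rw [← MonoidHom.mem_ker, QuotientGroup.ker_mk']
  obtain ⟨T, hST, hT, hcl⟩ := (hS.image π hπ).exists_rcomm_closed
  have hone : ∀ g ∈ T, g = 1 := by
    refine fun g hg => hT.eq_one_of_commute hcl (x := fun i => π (F.equivFin.symm i))
      (fun i => hST ⟨_, hFS (F.equivFin.symm i).2, rfl⟩) (fun g _ h => ?_) hg
    obtain ⟨g, rfl⟩ := hπ g
    refine (hker g).2 (mem_iSup_upperCentralSeries_of_finset hF fun x hx => ?_)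
    have := h (F.equivFin ⟨x, hx⟩)
    rw [Equiv.symm_apply_apply, ← commutatorElement_eq_one_iff_commute, ← map_commutatorElement,
      hker] at this
    exact this
  have hmem : ∀ x ∈ F, ∃ n, x ∈ Subgroup.upperCentralSeries G n := fun x hx =>
    (Subgroup.mem_iSup_of_directed directed_upperCentralSeries).1
      ((hker x).1 (hone _ (hST ⟨x, hFS hx, rfl⟩)))
  choose! n hn using hmem
  refine ⟨F.sup n, ?_⟩
  rw [eq_top_iff, ← hF, Subgroup.closure_le]
  exact fun x hx => Subgroup.upperCentralSeries_mono G (Finset.le_sup hx) (hn x hx)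

theorem exists_finset_mem_closure {X : Set G} {g : G} (hg : g ∈ Subgroup.closure X) :
    ∃ F : Finset G, (F : Set G) ⊆ X ∧ g ∈ Subgroup.closure (F : Set G) := by
  classical
  induction hg using Subgroup.closure_induction with
  | mem x hx => exact ⟨{x}, by simpa using hx, Subgroup.subset_closure (by simp)⟩
  | one => exact ⟨∅, by simp, one_mem _⟩
  | mul a b _ _ ha hb =>
    obtain ⟨E, hE, hE'⟩ := ha
    obtain ⟨F, hF, hF'⟩ := hb
    refine ⟨E ∪ F, by simp [hE, hF], mul_mem ?_ ?_⟩
    · exact Subgroup.closure_mono (by simp) hE'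
    · exact Subgroup.closure_mono (by simp) hF'
  | inv a _ ha =>
    obtain ⟨E, hE, hE'⟩ := ha
    exact ⟨E, hE, inv_mem hE'⟩

theorem Group.FG.exists_finset_subset (hG : Group.FG G) {X : Set G}
    (hX : Subgroup.closure X = ⊤) :
    ∃ F : Finset G, (F : Set G) ⊆ X ∧ Subgroup.closure (F : Set G) = ⊤ := by
  classical
  obtain ⟨E, hE⟩ := Group.fg_def.1 hG
  choose F hF hF' using fun g : G =>
    exists_finset_mem_closure (X := X) (g := g) (hX ▸ Subgroup.mem_top g)
  refine ⟨E.biUnion F, by simp [hF], ?_⟩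
  rw [eq_top_iff, ← hE, Subgroup.closure_le]
  intro g hg
  exact Subgroup.closure_mono (Finset.coe_subset.2 (Finset.subset_biUnion_of_mem F hg)) (hF' g)

/-! ### From strong sandwich sets to sandwich sets. -/

theorem IsNilpotentOfClassLE.lowerCentralSeries_eq_bot {H : Subgroup G} {n : ℕ}
    (h : IsNilpotentOfClassLE H n) : H.lowerCentralSeries n = ⊥ :=
  haveI := h.1
  Subgroup.lowerCentralSeries_eq_bot_of_nilpotencyClass_le h.2

theorem rcomm_mem_commutator {H : Subgroup G} {a b : G} (ha : a ∈ H) (hb : b ∈ H) :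
    rcomm a b ∈ ⁅H, H⁆ := by
  have : rcomm a b = ⁅a⁻¹, b⁻¹⁆ := by simp [rcomm, commutatorElement_def]
  rw [this]
  exact Subgroup.commutator_mem_commutator (inv_mem ha) (inv_mem hb)

theorem commute_of_commutator_eq_bot {H K : Subgroup G} (h : ⁅H, K⁆ = ⊥) {a b : G} (ha : a ∈ H)
    (hb : b ∈ K) : Commute a b := by
  rw [← commutatorElement_eq_one_iff_commute, ← Subgroup.mem_bot, ← h]
  exact Subgroup.commutator_mem_commutator ha hb

theorem IsNilpotentOfClassLE.commute_rcomm {H : Subgroup G} (h : IsNilpotentOfClassLE H 2)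
    {a x : G} (ha : a ∈ H) (hx : x ∈ H) : Commute (rcomm a x) a :=
  commute_of_commutator_eq_bot h.lowerCentralSeries_eq_bot (rcomm_mem_commutator ha hx) ha

/-- By the three subgroups lemma, class at most 3 makes the derived subgroup abelian. -/
theorem IsNilpotentOfClassLE.commute_rcomm_rcomm {H : Subgroup G} (h : IsNilpotentOfClassLE H 3)
    {a x y : G} (ha : a ∈ H) (hx : x ∈ H) (hy : y ∈ H) : Commute (rcomm a x) (rcomm a y) := by
  have h3 : ⁅⁅⁅H, H⁆, H⁆, H⁆ = ⊥ := h.lowerCentralSeries_eq_bot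
  refine commute_of_commutator_eq_bot
    (Subgroup.commutator_commutator_eq_bot_of_rotate ?_ h3)
    (rcomm_mem_commutator ha hx) (rcomm_mem_commutator ha hy)
  rwa [Subgroup.commutator_comm H]

/-- The conjugates of the elements of `X` and of their inverses, together with the identity. -/
def symmConj (X : Set G) : Set G :=
  {y | y = 1 ∨ ∃ x ∈ X, ∃ g, y = rconj x g ∨ y = (rconj x g)⁻¹}

theorem subset_symmConj (X : Set G) : X ⊆ symmConj X := fun x hx =>
  Or.inr ⟨x, hx, 1, Or.inl (rconj_one x).symm⟩

theorem rconj_mem_symmConj {X : Set G} {y : G} (hy : y ∈ symmConj X) (g : G) :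
    rconj y g ∈ symmConj X := by
  obtain rfl | ⟨x, hx, h, rfl | rfl⟩ := hy
  · exact Or.inl (one_rconj g)
  · exact Or.inr ⟨x, hx, h * g, Or.inl (rconj_rconj x h g)⟩
  · exact Or.inr ⟨x, hx, h * g, Or.inr (by rw [inv_rconj, rconj_rconj])⟩

/-- Inverses and the identity inherit the class conditions, which concern only the subgroup
generated. -/
theorem exists_rconj_of_mem_symmConj {X : Set G} (hX : X.Nonempty) {y : G} (hy : y ∈ symmConj X) :
    ∃ x ∈ X, ∃ g, ∀ H : Subgroup G, rconj x g ∈ H → y ∈ H := by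
  obtain rfl | ⟨x, hx, g, rfl | rfl⟩ := hy
  · obtain ⟨x, hx⟩ := hX
    exact ⟨x, hx, 1, fun H _ => one_mem H⟩
  · exact ⟨x, hx, g, fun H h => h⟩
  · exact ⟨x, hx, g, fun H h => inv_mem h⟩

/-- Write `a^x = a[a,x]` and `a^y = a[a,y]`: class two handles `a` against the commutators, class
three the commutators against each other. -/
theorem IsStrongSandwichSet.commute {X : Set G} (hX : IsStrongSandwichSet X)
    (htop : Subgroup.closure X = ⊤) {a x y : G} (ha : a ∈ X) (hx : x ∈ symmConj X)
    (hy : y ∈ symmConj X) : Commute (rconj a x) (rconj a y) := by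
  have hmem : ∀ g, g ∈ Subgroup.closure X := fun g => htop ▸ Subgroup.mem_top g
  have h2 : ∀ x ∈ symmConj X, Commute (rcomm a x) a := by
    intro x hx
    obtain ⟨b, hb, f, hf⟩ := exists_rconj_of_mem_symmConj ⟨a, ha⟩ hx
    exact (hX.class_two a ha b hb f (hmem f)).commute_rcomm (Subgroup.subset_closure (by simp))
      (hf _ (Subgroup.subset_closure (by simp [rconj])))
  obtain ⟨b, hb, f, hf⟩ := exists_rconj_of_mem_symmConj ⟨a, ha⟩ hx
  obtain ⟨c, hc, g, hg⟩ := exists_rconj_of_mem_symmConj ⟨a, ha⟩ hy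
  have h3 : Commute (rcomm a x) (rcomm a y) :=
    (hX.class_three a ha b hb c hc f (hmem f) g (hmem g)).commute_rcomm_rcomm
      (Subgroup.subset_closure (by simp)) (hf _ (Subgroup.subset_closure (by simp [rconj])))
      (hg _ (Subgroup.subset_closure (by simp [rconj])))
  rw [← mul_rcomm, ← mul_rcomm]
  exact ((Commute.refl a).mul_right (h2 y hy).symm).mul_left ((h2 x hx).mul_right h3)

theorem IsStrongSandwichSet.isSandwich_symmConj {X : Set G} (hX : IsStrongSandwichSet X)
    (htop : Subgroup.closure X = ⊤) : IsSandwich (symmConj X) where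
  one_mem := Or.inl rfl
  rconj_mem := fun _ ha g => rconj_mem_symmConj ha g
  inv_mem := by
    rintro _ (rfl | ⟨x, hx, g, rfl | rfl⟩)
    · exact Or.inl inv_one
    · exact Or.inr ⟨x, hx, g, Or.inr rfl⟩
    · exact Or.inr ⟨x, hx, g, Or.inl (inv_inv _)⟩
  commute := by
    have key : ∀ a ∈ X, ∀ g, ∀ x ∈ symmConj X, ∀ y ∈ symmConj X,
        Commute (rconj (rconj a g) x) (rconj (rconj a g) y) := by
      intro a ha g x hx y hy
      -- Pulling `g` outside reduces to `a ∈ X`, since `symmConj X` is closed under conjugation.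
      have h : ∀ z, rconj (rconj a g) z = rconj (rconj a (rconj z g⁻¹)) g := fun z => by
        simp [rconj, mul_assoc]
      rw [h, h, commute_rconj_rconj_iff]
      exact hX.commute htop ha (rconj_mem_symmConj hx _) (rconj_mem_symmConj hy _)
    rintro _ (rfl | ⟨a, ha, g, rfl | rfl⟩) x hx y hy
    · rw [one_rconj]; exact Commute.one_left _
    · exact key a ha g x hx y hy
    · rw [inv_rconj, inv_rconj]
      exact (key a ha g x hx y hy).inv_inv

end Nilpotent

theorem theorem2p2 (G : Type*) [Group G] (hfg : Group.FG G) (hG : IsStrongSandwichGroup G) :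
    Group.IsNilpotent G := by
  obtain ⟨X, hX, htop⟩ := hG
  obtain ⟨F, hFX, hF⟩ := hfg.exists_finset_subset htop
  exact (hX.isSandwich_symmConj htop).isNilpotent F (hFX.trans (subset_symmConj X)) hF
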